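/- Let $m,n\ge 1$ be integers, $N=\min(m,n)$, and let $K$ be an integer with $1\le K<N$. Equip the space $\mathbb{M}_{m,n}$ of complex $m\times n$ matrices with the Frobenius norm $\|\cdot\|$ and the real inner product $\langle A,B\rangle=\operatorname{Re}\operatorname{tr}(B^*A)$. Fix $F\in\mathbb{M}_{m,n}$ and define $\mathcal I:\mathbb{M}_{m,n}\to(-\infty,\infty]$ by $$\mathcal I(A)=\mathcal R_K(A)+\|A-F\|^2,\qquad \mathcal R_K(A)=\begin{cases}0,&\operatorname{rank}A\le K,\\ \infty,&\text{otherwise.}\end{cases}$$ For an extended-real-valued function $f$ on $\mathbb{M}_{m,n}$ let $f^*(B)=\sup_A\left(\langle A,B\rangle-f(A)\right)$ be its Fenchel conjugate and $f^{**}=(f^*)^*$ its biconjugate. Then $\mathcal I^{**}$ is the convex envelope of $\mathcal I$, i.e. the largest convex function $\mathbb{M}_{m,n}\to[-\infty,\infty]$ (convex meaning that the epigraph is convex) that is bounded above by $\mathcal I$. Moreover, for every $A\in\mathbb{M}_{m,n}$ with singular values $\alpha_1\ge\alpha_2\ge\dots\ge\alpha_N\ge 0$, put $\alpha_0=\infty$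 and $$\omega_k=\frac1k\sum_{j=K-k+1}^N\alpha_j\qquad(1\le k\le K);$$ there is a unique $k_*\in\{1,\dots,K\}$ such that $\alpha_{K-k_*+1}\le\omega_{k_*}<\alpha_{K-k_*}$, and $$\mathcal I^{**}(A)=\frac1{k_*}\Bigl(\sum_{j=K-k_*+1}^N\alpha_j\Bigr)^2-\sum_{j=K-k_*+1}^N\alpha_j^2+\|A-F\|^2 .$$ -/

import Mathlib

attribute [local instance] Matrix.frobeniusNormedAddCommGroup

namespace FixedRank

/-- `sv A j` is the `j`-th largest singular value of the matrix `A`, for `j = 1, 2, …`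
(the index is one-based; the value at `j = 0` is never used). -/
noncomputable def sv {m n : ℕ} (A : Matrix (Fin m) (Fin n) ℂ) (j : ℕ) : ℝ :=
  (Matrix.toEuclideanLin A).singularValues (j - 1)

/-- The real inner product `Re tr (B* A)` on complex matrices; it induces the Frobenius norm. -/
noncomputable def frobInner {m n : ℕ} (A B : Matrix (Fin m) (Fin n) ℂ) : ℝ :=
  (Matrix.trace (B.conjTranspose * A)).re

/-- The indicator function of the set of matrices of rank at most `K`. -/
noncomputable def rankIndicator {m n : ℕ} (K : ℕ) (A : Matrix (Fin m) (Fin n) ℂ) : EReal :=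
  if A.rank ≤ K then 0 else ⊤

/-- The functional `A ↦ R_K(A) + ‖A - F‖²`, with the Frobenius norm. -/
noncomputable def fixedRankFunctional {m n : ℕ} (K : ℕ) (F A : Matrix (Fin m) (Fin n) ℂ) : EReal :=
  rankIndicator K A + ((‖A - F‖ ^ 2 : ℝ) : EReal)

/-- The Fenchel conjugate `f*(B) = sup_A (⟨A, B⟩ - f(A))`. -/
noncomputable def fenchelConj {m n : ℕ} (f : Matrix (Fin m) (Fin n) ℂ → EReal)
    (B : Matrix (Fin m) (Fin n) ℂ) : EReal :=
  ⨆ A : Matrix (Fin m) (Fin n) ℂ, ((frobInner A B : ℝ) : EReal) - f A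

/-- An extended-real-valued function is convex if its epigraph is convex. -/
def IsConvex {m n : ℕ} (f : Matrix (Fin m) (Fin n) ℂ → EReal) : Prop :=
  Convex ℝ {p : Matrix (Fin m) (Fin n) ℂ × ℝ | f p.1 ≤ (p.2 : EReal)}

/-- `h` is the convex envelope of `f`, that is, the largest convex function below `f`. -/
def IsConvexEnvelope {m n : ℕ} (f h : Matrix (Fin m) (Fin n) ℂ → EReal) : Prop :=
  IsGreatest {g : Matrix (Fin m) (Fin n) ℂ → EReal | IsConvex g ∧ g ≤ f} h

/-- `ω_k = (∑_{j > K - k} β_j) / k` for the sequence `β_1, …, β_N`, where `1 ≤ k ≤ K`. -/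
noncomputable def omega (N K : ℕ) (β : ℕ → ℝ) (k : ℕ) : ℝ :=
  (∑ j ∈ Finset.Icc (K - k + 1) N, β j) / k

/-- `k` satisfies `1 ≤ k ≤ K` and `β_{K-k+1} ≤ ω_k < β_{K-k}`. By the convention `β_0 = ∞` the
second inequality is void when `k = K`. -/
def IsKStar (N K : ℕ) (β : ℕ → ℝ) (k : ℕ) : Prop :=
  1 ≤ k ∧ k ≤ K ∧ β (K - k + 1) ≤ omega N K β k ∧ (k < K → omega N K β k < β (K - k))

end FixedRank

/-!
Up to the term `-2⟨A, F⟩ + ‖F‖²`, which is affine in `A`, the functional is `R_K + ‖·‖²`, and the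
claimed envelope of the latter at `A` is `q = ∑_{j ≤ p} α_j² + k ω²`, where `k = k_*`, `p = K - k`
and `ω = ω_k`: the singular values after the `p`-th, which sum to `k ω` and are at most `ω`, are
traded for `k` copies of `ω`. Everything happens in an orthonormal basis `v_j` of eigenvectors of
`A* A`, by means of the matrices `rescale A d`, which send `v_j` to `d_j A v_j`.

*Lower bound.* Let `C` be `A` with the nonzero singular values after the `p`-th raised to `ω`. A
matrix `X` of rank at most `K` satisfies `2⟨X, C⟩ - ‖X‖² ≤ q`
(`two_mul_frobInner_rescale_sub_le`), while `⟨C, A⟩ = q`. Hence `2C - 2F` shows that the biconjugate at `A` is at least the claimed value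
(`IsFlattening.le_fenchelConj_fenchelConj`).

*Upper bound.* The numbers `α_j / ω`, `j > p`, lie in `[0, 1]` and sum to `k`
(unless `ω = 0`, when `A` itself has rank at most `K`). Setting the first `p`
coordinates to `1` gives a point of the hypersimplex, whose vertices are the indicators of the
`K`-element sets (`mem_of_mem_hypersimplex`). So `A` is a convex combination of matrices of rank at
most `K` and squared norm at most `q`, and *every* convex function below the functional is at most
the claimed value at `A` (`IsFlattening.le_of_isConvex`).

The biconjugate is itself convex and below the functional, so the two bounds give both the formula
and the maximality, with no appeal to the Fenchel–Moreau theorem and no semicontinuity or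
finiteness assumption on the competitors. That `k_*` exists and is unique rests on the equivalence
of `α_{K-k} ≤ ω_k` and `α_{K-k} ≤ ω_{k+1}` (`le_omega_succ_iff`).
-/

namespace FixedRank

open Matrix
open scoped InnerProductSpace

/-! ### The hypersimplex -/

/-- A convex set that contains the indicators of all `k`-element sets contains the hypersimplex
they span. A point with a fractional coordinate has two of them, as the sum is an integer, and lies
on a segment in the direction `e_i - e_j` whose endpoints have fewer fractional coordinates. -/
theorem mem_of_mem_hypersimplex {ι : Type*} [Fintype ι] {C : Set (ι → ℝ)}
    (hC : Convex ℝ C) {k : ℕ}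
    (hvert : ∀ S : Finset ι, S.card = k → (S : Set ι).indicator (fun _ => (1 : ℝ)) ∈ C)
    (x : ι → ℝ) (h0 : ∀ i, 0 ≤ x i) (h1 : ∀ i, x i ≤ 1) (hsum : ∑ i, x i = k) : x ∈ C := by
  classical
  induction hN : (Finset.univ.filter fun i => x i ≠ 0 ∧ x i ≠ 1).card using
    Nat.strong_induction_on generalizing x with
  | _ N ih =>
  by_cases hfrac : ∃ i, x i ≠ 0 ∧ x i ≠ 1
  · obtain ⟨i, hi0, hi1⟩ := hfrac
    obtain ⟨j, hji, hj0, hj1⟩ : ∃ j, j ≠ i ∧ x j ≠ 0 ∧ x j ≠ 1 := by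
      by_contra! hno
      have hrest : ∑ j ∈ Finset.univ.erase i, x j =
          (((Finset.univ.erase i).filter fun j => x j = 1).card : ℝ) := by
        rw [Finset.card_filter]
        push_cast
        refine Finset.sum_congr rfl fun j hj => ?_
        by_cases hj0 : x j = 0
        · simp [hj0]
        · simp [hno j (Finset.ne_of_mem_erase hj) hj0]
      have hsplit := Finset.add_sum_erase Finset.univ x (Finset.mem_univ i)
      rw [hrest, hsum] at hsplit
      have hlow : (((Finset.univ.erase i).filter fun j => x j = 1).card : ℝ) < k := by
        linarith [lt_of_le_of_ne (h0 i) (Ne.symm hi0)]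
      have hupp : (k : ℝ) < ((Finset.univ.erase i).filter fun j => x j = 1).card + 1 := by
        linarith [lt_of_le_of_ne (h1 i) hi1]
      norm_cast at hlow hupp
      omega
    -- Moving mass from `u` to `v` until one of the two becomes integral.
    have shift : ∀ u v, u ≠ v → x u ≠ 0 → x u ≠ 1 → x v ≠ 0 → x v ≠ 1 →
        x + min (x u) (1 - x v) • (Pi.single v 1 - Pi.single u 1) ∈ C := by
      intro u v huv hu0 hu1 hv0 hv1
      set a := min (x u) (1 - x v) with ha
      have ha0 : 0 ≤ a := le_min (h0 u) (by linarith [h1 v])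
      have hau : a ≤ x u := min_le_left _ _
      have hav : a ≤ 1 - x v := min_le_right _ _
      set y := x + a • (Pi.single v 1 - Pi.single u 1 : ι → ℝ) with hy
      have hyu : y u = x u - a := by simp [hy, huv]; ring
      have hyv : y v = x v + a := by simp [hy, huv.symm]
      have hyw : ∀ w, w ≠ u → w ≠ v → y w = x w := by
        intro w hwu hwv; simp [hy, hwu, hwv]
      refine ih _ ?_ y ?_ ?_ ?_ rfl
      · rw [← hN]
        apply Finset.card_lt_card
        rw [Finset.ssubset_iff_of_subset]
        · rcases min_choice (x u) (1 - x v) with h | h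
          · exact ⟨u, by simp [hu0, hu1], by simp [hyu, ha, h]⟩
          · exact ⟨v, by simp [hv0, hv1], by simp [hyv, ha, h]⟩
        · intro w hw
          by_cases hwu : w = u
          · subst hwu; simp [hu0, hu1]
          by_cases hwv : w = v
          · subst hwv; simp [hv0, hv1]
          simpa [hyw w hwu hwv] using hw
      · intro w
        by_cases hwu : w = u
        · subst hwu; linarith
        by_cases hwv : w = v
        · subst hwv; linarith [h0 w]
        rw [hyw w hwu hwv]; exact h0 w
      · intro w
        by_cases hwu : w = u
        · subst hwu; linarith [h1 w]
        by_cases hwv : w = v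
        · subst hwv; linarith
        rw [hyw w hwu hwv]; exact h1 w
      · simp [hy, Finset.sum_add_distrib, ← Finset.mul_sum, hsum]
    have hy := shift i j hji.symm hi0 hi1 hj0 hj1
    have hz := shift j i hji hj0 hj1 hi0 hi1
    set a := min (x i) (1 - x j)
    set b := min (x j) (1 - x i)
    have ha : 0 < a := lt_min (lt_of_le_of_ne (h0 i) (Ne.symm hi0))
      (by linarith [lt_of_le_of_ne (h1 j) hj1])
    have hb : 0 < b := lt_min (lt_of_le_of_ne (h0 j) (Ne.symm hj0))
      (by linarith [lt_of_le_of_ne (h1 i) hi1])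
    have key := hC hy hz (a := b / (a + b)) (b := a / (a + b)) (by positivity) (by positivity)
      (by field_simp; ring)
    convert key using 1
    ext w
    simp only [Pi.add_apply, Pi.smul_apply, Pi.sub_apply, smul_eq_mul]
    field_simp
    ring
  · push Not at hfrac
    have hx : x = ((Finset.univ.filter fun i => x i = 1 : Finset ι) : Set ι).indicator
        (fun _ => (1 : ℝ)) := by
      ext i
      by_cases hi : x i = 0
      · simp [Set.indicator, hi]
      · simp [Set.indicator, hfrac i hi]
    rw [hx]
    refine hvert _ ?_
    have : ((Finset.univ.filter fun i => x i = 1).card : ℝ) = k := by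
      rw [← hsum, Finset.card_filter]
      push_cast
      refine Finset.sum_congr rfl fun i _ => ?_
      by_cases hi : x i = 0
      · simp [hi]
      · simp [hfrac i hi]
    exact_mod_cast this

/-! ### The index `k_*` -/

/-- `ω_{k+1}` is a weighted mean of `ω_k` and `β_{K-k}`, because
`(k + 1) ω_{k+1} = k ω_k + β_{K-k}`. -/
theorem le_omega_succ_iff {N K : ℕ} (hKN : K < N) (β : ℕ → ℝ) {k : ℕ} (hk : 1 ≤ k) (hkK : k < K) :
    β (K - k) ≤ omega N K β (k + 1) ↔ β (K - k) ≤ omega N K β k := by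
  have hk0 : (0 : ℝ) < k := by exact_mod_cast hk
  have hIcc : Finset.Icc (K - (k + 1) + 1) N = insert (K - k) (Finset.Icc (K - k + 1) N) := by
    ext j; simp only [Finset.mem_Icc, Finset.mem_insert]; omega
  unfold omega
  rw [hIcc, Finset.sum_insert (by simp), le_div_iff₀ (by positivity), le_div_iff₀ hk0]
  push_cast
  constructor <;> intro h <;> linarith

theorem existsUnique_isKStar {N K : ℕ} (hK : 1 ≤ K) (hKN : K < N) {β : ℕ → ℝ}
    (hanti : Antitone β) (hnonneg : ∀ j, 0 ≤ β j) : ∃! k, IsKStar N K β k := by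
  classical
  have step : ∀ k, 1 ≤ k → k < K → β (K - k) ≤ omega N K β (k + 1) →
      β (K - k + 1) ≤ omega N K β k := fun k hk hkK h =>
    (hanti (Nat.le_succ _)).trans ((le_omega_succ_iff hKN β hk hkK).1 h)
  -- The condition `β_{K-k+1} ≤ ω_k` is inherited by smaller `k`, so `k_*` is the largest such `k`.
  have down : ∀ k l, 1 ≤ k → k ≤ l → l ≤ K → β (K - l + 1) ≤ omega N K β l →
      β (K - k + 1) ≤ omega N K β k := by
    intro k l hk hkl
    induction l, hkl using Nat.le_induction with
    | base => exact fun _ h => h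
    | succ l hkl ih =>
      intro hlK h
      refine ih (by omega) (step l (by omega) (by omega) ?_)
      rwa [show K - (l + 1) + 1 = K - l by omega] at h
  have hone : β (K - 1 + 1) ≤ omega N K β 1 := by
    unfold omega
    simp only [Nat.cast_one, div_one]
    exact Finset.single_le_sum (f := β) (fun j _ => hnonneg j)
      (Finset.mem_Icc.2 ⟨le_rfl, by omega⟩)
  let P : ℕ → Prop := fun k => 1 ≤ k ∧ β (K - k + 1) ≤ omega N K β k
  have hP : P (Nat.findGreatest P K) := Nat.findGreatest_spec (P := P) hK ⟨le_rfl, hone⟩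
  refine ⟨Nat.findGreatest P K, ⟨hP.1, Nat.findGreatest_le K, hP.2, fun hlt => ?_⟩, ?_⟩
  · by_contra! hle
    refine Nat.findGreatest_is_greatest (Nat.lt_succ_self (Nat.findGreatest P K)) hlt
      ⟨by omega, ?_⟩
    rw [show K - (Nat.findGreatest P K).succ + 1 = K - Nat.findGreatest P K by omega]
    exact (le_omega_succ_iff hKN β hP.1 hlt).2 hle
  · rintro k ⟨hk, hkK, hle, hlt⟩
    refine le_antisymm (Nat.le_findGreatest hkK ⟨hk, hle⟩) ?_
    by_contra! hgt
    have hkK' : k < K := hgt.trans_le (Nat.findGreatest_le K)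
    have := down (k + 1) _ (by omega) hgt (Nat.findGreatest_le K) hP.2
    rw [show K - (k + 1) + 1 = K - k by omega] at this
    exact absurd (hlt hkK') (not_lt.2 ((le_omega_succ_iff hKN β hk hkK').1 this))

/-! ### The Frobenius inner product -/

section frob
variable {m n : ℕ}

theorem frobInner_comm (A B : Matrix (Fin m) (Fin n) ℂ) : frobInner A B = frobInner B A := by
  unfold frobInner
  rw [← conjTranspose_conjTranspose A, ← conjTranspose_mul, trace_conjTranspose,
    conjTranspose_conjTranspose]
  simp

theorem frobInner_add_left (A A' B : Matrix (Fin m) (Fin n) ℂ) :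
    frobInner (A + A') B = frobInner A B + frobInner A' B := by
  simp [frobInner, Matrix.mul_add]

theorem frobInner_sub_left (A A' B : Matrix (Fin m) (Fin n) ℂ) :
    frobInner (A - A') B = frobInner A B - frobInner A' B := by
  simp [frobInner, Matrix.mul_sub]

theorem frobInner_smul_left (t : ℝ) (A B : Matrix (Fin m) (Fin n) ℂ) :
    frobInner (t • A) B = t * frobInner A B := by
  simp [frobInner]

/-- The trace in `frobInner` may be computed in any orthonormal basis of the domain. -/
theorem frobInner_eq_sum (b : OrthonormalBasis (Fin n) ℂ (EuclideanSpace ℂ (Fin n)))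
    (A B : Matrix (Fin m) (Fin n) ℂ) :
    frobInner A B = ∑ j, (⟪toEuclideanLin B (b j), toEuclideanLin A (b j)⟫_ℂ).re := by
  have h : (Bᴴ * A).trace = LinearMap.trace ℂ _ ((toEuclideanLin Bᴴ) ∘ₗ (toEuclideanLin A)) := by
    rw [← Matrix.trace_toLin_eq (Bᴴ * A) (PiLp.basisFun 2 ℂ (Fin n)),
      Matrix.toLin_mul _ (PiLp.basisFun 2 ℂ (Fin m))]
    simp [toLpLin_eq_toLin]
  rw [frobInner, h, LinearMap.trace_eq_sum_inner _ b, Complex.re_sum]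
  refine Finset.sum_congr rfl fun j _ => ?_
  rw [LinearMap.comp_apply, toEuclideanLin_conjTranspose_eq_adjoint,
    LinearMap.adjoint_inner_right]

theorem norm_sq_eq_frobInner (A : Matrix (Fin m) (Fin n) ℂ) : ‖A‖ ^ 2 = frobInner A A := by
  rw [frobenius_norm_def, ← Real.sqrt_eq_rpow, Real.sq_sqrt (by positivity), frobInner,
    Finset.sum_comm]
  simp only [trace, diag_apply, mul_apply, conjTranspose_apply, Complex.re_sum]
  refine Finset.sum_congr rfl fun j _ => Finset.sum_congr rfl fun i _ => ?_
  rw [Complex.star_def, Complex.conj_mul']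
  norm_cast

theorem norm_sub_sq_eq (A F : Matrix (Fin m) (Fin n) ℂ) :
    ‖A - F‖ ^ 2 = ‖A‖ ^ 2 - 2 * frobInner A F + ‖F‖ ^ 2 := by
  rw [norm_sq_eq_frobInner, norm_sq_eq_frobInner, norm_sq_eq_frobInner, frobInner_sub_left,
    frobInner_comm A (A - F), frobInner_comm F (A - F), frobInner_sub_left, frobInner_sub_left,
    frobInner_comm F A]
  ring

end frob

/-! ### Fenchel conjugates -/

section conj
variable {m n : ℕ}

theorem isConvex_fenchelConj (f : Matrix (Fin m) (Fin n) ℂ → EReal) :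
    IsConvex (fenchelConj f) := by
  unfold IsConvex
  have : {p : Matrix (Fin m) (Fin n) ℂ × ℝ | fenchelConj f p.1 ≤ (p.2 : EReal)} =
      ⋂ A, {p | ((frobInner A p.1 : ℝ) : EReal) - f A ≤ (p.2 : EReal)} := by
    ext p; simp [fenchelConj]
  rw [this]
  refine convex_iInter fun A => ?_
  induction f A using EReal.rec with
  | bot =>
    convert convex_empty
    ext p; simp [EReal.sub_bot]
  | top =>
    convert convex_univ
    ext p; simp
  | coe c =>
    intro p hp q hq s t hs ht hst
    simp only [Set.mem_ofPred_eq] at hp hq ⊢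
    norm_cast at hp hq ⊢
    simp only [Prod.fst_add, Prod.smul_fst, Prod.snd_add, Prod.smul_snd, smul_eq_mul]
    rw [frobInner_comm, frobInner_add_left, frobInner_smul_left, frobInner_smul_left,
      frobInner_comm p.1, frobInner_comm q.1]
    have := add_le_add (mul_le_mul_of_nonneg_left hp hs) (mul_le_mul_of_nonneg_left hq ht)
    have hc : c = s * c + t * c := by rw [← add_mul, hst, one_mul]
    linarith

theorem fenchelConj_fenchelConj_le (f : Matrix (Fin m) (Fin n) ℂ → EReal) :
    fenchelConj (fenchelConj f) ≤ f := by
  intro A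
  refine iSup_le fun B => ?_
  have h : ((frobInner A B : ℝ) : EReal) - f A ≤ fenchelConj f B :=
    le_iSup (fun A => ((frobInner A B : ℝ) : EReal) - f A) A
  rw [frobInner_comm]
  generalize f A = y at h ⊢
  induction y using EReal.rec with
  | bot =>
    rw [EReal.sub_bot (by simp), top_le_iff] at h
    simp [h]
  | top => exact le_top
  | coe a =>
    refine (EReal.sub_le_sub le_rfl h).trans (le_of_eq ?_)
    norm_cast
    ring

end conj

/-! ### Rescaling singular values -/

section rescale
variable {m n : ℕ}

theorem inner_apply_eigenvectorBasis_adjoint_comp_self {E F : Type*}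
    [NormedAddCommGroup E] [InnerProductSpace ℂ E] [FiniteDimensional ℂ E]
    [NormedAddCommGroup F] [InnerProductSpace ℂ F] [FiniteDimensional ℂ F] (T : E →ₗ[ℂ] F)
    (hn : Module.finrank ℂ E = n) (i j : Fin n) :
    ⟪T (T.isSymmetric_adjoint_comp_self.eigenvectorBasis hn i),
      T (T.isSymmetric_adjoint_comp_self.eigenvectorBasis hn j)⟫_ℂ =
      if i = j then ((T.singularValues j ^ 2 : ℝ) : ℂ) else 0 := by
  have h := T.isSymmetric_adjoint_comp_self.apply_eigenvectorBasis hn j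
  rw [LinearMap.comp_apply] at h
  have horth := orthonormal_iff_ite.1
    (T.isSymmetric_adjoint_comp_self.eigenvectorBasis hn).orthonormal i j
  rw [← LinearMap.adjoint_inner_right, h, inner_smul_right, horth, mul_ite, mul_one, mul_zero,
    T.sq_singularValues_fin hn]
  rfl

/-- An orthonormal eigenbasis of `A* A`, ordered by decreasing eigenvalue; it consists of right
singular vectors of `A`. -/
noncomputable def rightBasis (A : Matrix (Fin m) (Fin n) ℂ) :
    OrthonormalBasis (Fin n) ℂ (EuclideanSpace ℂ (Fin n)) :=
  (toEuclideanLin A).isSymmetric_adjoint_comp_self.eigenvectorBasis finrank_euclideanSpace_fin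

theorem inner_apply_rightBasis (A : Matrix (Fin m) (Fin n) ℂ) (i j : Fin n) :
    ⟪toEuclideanLin A (rightBasis A i), toEuclideanLin A (rightBasis A j)⟫_ℂ =
      if i = j then (((toEuclideanLin A).singularValues j ^ 2 : ℝ) : ℂ) else 0 :=
  inner_apply_eigenvectorBasis_adjoint_comp_self (toEuclideanLin A) finrank_euclideanSpace_fin i j

theorem norm_sq_apply_rightBasis (A : Matrix (Fin m) (Fin n) ℂ) (j : Fin n) :
    ‖toEuclideanLin A (rightBasis A j)‖ ^ 2 = (toEuclideanLin A).singularValues j ^ 2 := by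
  rw [← inner_self_eq_norm_sq (𝕜 := ℂ), inner_apply_rightBasis, if_pos rfl]
  exact Complex.ofReal_re _

/-- The matrix obtained from `A` by multiplying its `j`-th singular value by `d j`, keeping the
singular vectors: it sends the `j`-th right singular vector `v_j` to `d j • A v_j`. -/
noncomputable def rescale (A : Matrix (Fin m) (Fin n) ℂ) (d : Fin n → ℝ) :
    Matrix (Fin m) (Fin n) ℂ :=
  toEuclideanLin.symm ((rightBasis A).toBasis.constr ℂ
    fun j => (d j : ℂ) • toEuclideanLin A (rightBasis A j))

theorem rescale_apply_rightBasis (A : Matrix (Fin m) (Fin n) ℂ) (d : Fin n → ℝ) (j : Fin n) :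
    toEuclideanLin (rescale A d) (rightBasis A j) =
      (d j : ℂ) • toEuclideanLin A (rightBasis A j) := by
  rw [rescale, LinearEquiv.apply_symm_apply]
  simp [-OrthonormalBasis.coe_toBasis]

theorem eq_of_apply_rightBasis {A B C : Matrix (Fin m) (Fin n) ℂ}
    (h : ∀ j, toEuclideanLin B (rightBasis A j) = toEuclideanLin C (rightBasis A j)) : B = C := by
  apply toEuclideanLin.injective
  refine (rightBasis A).toBasis.ext fun j => ?_
  simpa using h j

theorem rescale_linear (A : Matrix (Fin m) (Fin n) ℂ) (s t : ℝ) (d e : Fin n → ℝ) :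
    rescale A (s • d + t • e) = s • rescale A d + t • rescale A e := by
  refine eq_of_apply_rightBasis (A := A) fun j => ?_
  have hs : ∀ (r : ℝ) (M : Matrix (Fin m) (Fin n) ℂ), r • M = (r : ℂ) • M := by
    intro r M; ext; simp
  rw [hs, hs, map_add, map_smul, map_smul, LinearMap.add_apply, LinearMap.smul_apply,
    LinearMap.smul_apply]
  simp only [rescale_apply_rightBasis]
  rw [smul_smul, smul_smul, ← add_smul]
  simp

theorem rescale_eq_self {A : Matrix (Fin m) (Fin n) ℂ} {d : Fin n → ℝ}
    (h : ∀ j, d j * (toEuclideanLin A).singularValues j = (toEuclideanLin A).singularValues j) :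
    rescale A d = A := by
  refine eq_of_apply_rightBasis (A := A) fun j => ?_
  rw [rescale_apply_rightBasis]
  by_cases hs : (toEuclideanLin A).singularValues j = 0
  · have : toEuclideanLin A (rightBasis A j) = 0 := by
      have := norm_sq_apply_rightBasis A j
      rw [hs] at this
      simpa using this
    rw [this, smul_zero]
  · rw [mul_eq_right₀ hs |>.1 (h j)]
    simp

theorem inner_rescale_rightBasis (A : Matrix (Fin m) (Fin n) ℂ) (d : Fin n → ℝ) (i j : Fin n) :
    ⟪toEuclideanLin (rescale A d) (rightBasis A i),
      toEuclideanLin (rescale A d) (rightBasis A j)⟫_ℂ =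
      if i = j then (((d j * (toEuclideanLin A).singularValues j) ^ 2 : ℝ) : ℂ) else 0 := by
  rw [rescale_apply_rightBasis, rescale_apply_rightBasis, inner_smul_left, inner_smul_right,
    inner_apply_rightBasis]
  split_ifs with h
  · subst h
    rw [Complex.conj_ofReal]
    push_cast
    ring
  · simp

theorem norm_rescale_sq (A : Matrix (Fin m) (Fin n) ℂ) (d : Fin n → ℝ) :
    ‖rescale A d‖ ^ 2 = ∑ j, (d j * (toEuclideanLin A).singularValues j) ^ 2 := by
  rw [norm_sq_eq_frobInner, frobInner_eq_sum (rightBasis A)]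
  refine Finset.sum_congr rfl fun j _ => ?_
  rw [inner_rescale_rightBasis, if_pos rfl, Complex.ofReal_re]

theorem norm_sq_eq_sum_singularValues (A : Matrix (Fin m) (Fin n) ℂ) :
    ‖A‖ ^ 2 = ∑ j : Fin n, (toEuclideanLin A).singularValues j ^ 2 := by
  conv_lhs => rw [← rescale_eq_self (A := A) (d := fun _ => 1) (by simp), norm_rescale_sq]
  simp

theorem frobInner_rescale_self (A : Matrix (Fin m) (Fin n) ℂ) (d : Fin n → ℝ) :
    frobInner (rescale A d) A = ∑ j, d j * (toEuclideanLin A).singularValues j ^ 2 := by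
  rw [frobInner_eq_sum (rightBasis A)]
  refine Finset.sum_congr rfl fun j _ => ?_
  rw [rescale_apply_rightBasis, inner_smul_right, inner_apply_rightBasis, if_pos rfl,
    ← Complex.ofReal_mul, Complex.ofReal_re]

theorem norm_rescale_apply_sq (A : Matrix (Fin m) (Fin n) ℂ) (d : Fin n → ℝ)
    (v : EuclideanSpace ℂ (Fin n)) :
    ‖toEuclideanLin (rescale A d) v‖ ^ 2 =
      ∑ j, (d j * (toEuclideanLin A).singularValues j) ^ 2 * ‖⟪rightBasis A j, v⟫_ℂ‖ ^ 2 := by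
  have hv : toEuclideanLin (rescale A d) v =
      ∑ j, ⟪rightBasis A j, v⟫_ℂ • toEuclideanLin (rescale A d) (rightBasis A j) := by
    conv_lhs => rw [← (rightBasis A).sum_repr' v, map_sum]
    simp only [map_smul]
  have h : ⟪toEuclideanLin (rescale A d) v, toEuclideanLin (rescale A d) v⟫_ℂ =
      ((∑ j, (d j * (toEuclideanLin A).singularValues j) ^ 2 *
        ‖⟪rightBasis A j, v⟫_ℂ‖ ^ 2 : ℝ) : ℂ) := by
    rw [hv]
    simp only [sum_inner, inner_sum, inner_smul_left, inner_smul_right, inner_rescale_rightBasis,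
      mul_ite, mul_zero, Finset.sum_ite_eq', Finset.mem_univ, if_true]
    push_cast
    refine Finset.sum_congr rfl fun j _ => ?_
    rw [← Complex.conj_mul']
    ring
  rw [← inner_self_eq_norm_sq (𝕜 := ℂ), h]
  exact Complex.ofReal_re _

theorem rank_rescale_le (A : Matrix (Fin m) (Fin n) ℂ) (d : Fin n → ℝ) (S : Finset (Fin n))
    (hd : ∀ j, j ∉ S → d j = 0) : (rescale A d).rank ≤ S.card := by
  classical
  rw [rank_eq_finrank_range_toLin _ (PiLp.basisFun 2 ℂ (Fin m)) (PiLp.basisFun 2 ℂ (Fin n)),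
    ← toLpLin_eq_toLin]
  have hle : LinearMap.range (toEuclideanLin (rescale A d)) ≤
      Submodule.span ℂ ((S.image fun j => toEuclideanLin A (rightBasis A j) :
        Finset (EuclideanSpace ℂ (Fin m))) : Set (EuclideanSpace ℂ (Fin m))) := by
    rw [LinearMap.range_eq_map, ← (rightBasis A).toBasis.span_eq, Submodule.map_span,
      Submodule.span_le]
    rintro _ ⟨_, ⟨j, rfl⟩, rfl⟩
    rw [OrthonormalBasis.coe_toBasis, rescale_apply_rightBasis]
    by_cases hj : j ∈ S
    · exact Submodule.smul_mem _ _ (Submodule.subset_span (by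
        simp only [Finset.coe_image]; exact ⟨j, hj, rfl⟩))
    · simp [hd j hj]
  exact (Submodule.finrank_mono hle).trans
    ((finrank_span_finset_le_card _).trans Finset.card_image_le)

theorem finrank_range_toEuclideanLin (A : Matrix (Fin m) (Fin n) ℂ) :
    Module.finrank ℂ (LinearMap.range (toEuclideanLin A)) = A.rank := by
  rw [rank_eq_finrank_range_toLin _ (PiLp.basisFun 2 ℂ (Fin m)) (PiLp.basisFun 2 ℂ (Fin n)),
    ← toLpLin_eq_toLin]

end rescale

/-! ### Testing against matrices of bounded rank -/

section weights

/-- Water-filling estimate: spreading a total weight of at most `p + k` over numbers that are at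
least `ω` in absolute value at the first `p` positions and at most `ω` elsewhere does best by
filling the first `p` positions. -/
theorem sum_sq_mul_le {n p k : ℕ} (hp : p ≤ n) {c w : Fin n → ℝ} {ω : ℝ}
    (hlow : ∀ j : Fin n, (j : ℕ) < p → ω ^ 2 ≤ c j ^ 2)
    (hupp : ∀ j : Fin n, p ≤ (j : ℕ) → c j ^ 2 ≤ ω ^ 2)
    (h0 : ∀ j, 0 ≤ w j) (h1 : ∀ j, w j ≤ 1) (hsum : ∑ j, w j ≤ (p + k : ℕ)) :
    ∑ j, c j ^ 2 * w j ≤ (∑ j : Fin n, if (j : ℕ) < p then c j ^ 2 else 0) + k * ω ^ 2 := by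
  have hterm : ∀ j, c j ^ 2 * w j ≤
      ω ^ 2 * w j + ((if (j : ℕ) < p then c j ^ 2 else 0) - if (j : ℕ) < p then ω ^ 2 else 0) := by
    intro j
    split_ifs with hj
    · nlinarith [hlow j hj, h1 j]
    · nlinarith [hupp j (not_lt.1 hj), h0 j]
  have hcard : (∑ j : Fin n, if (j : ℕ) < p then ω ^ 2 else 0) = p * ω ^ 2 := by
    rw [Fin.sum_univ_eq_sum_range (fun i => if i < p then ω ^ 2 else 0), ← Finset.sum_filter,
      Finset.sum_const, nsmul_eq_mul]
    congr 2
    rw [show (Finset.range n).filter (· < p) = Finset.range p by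
      ext i; simp only [Finset.mem_filter, Finset.mem_range]; omega, Finset.card_range]
  have := Finset.sum_le_sum fun j (_ : j ∈ Finset.univ) => hterm j
  rw [Finset.sum_add_distrib, Finset.sum_sub_distrib, ← Finset.mul_sum, hcard] at this
  push_cast at hsum
  nlinarith [mul_le_mul_of_nonneg_left hsum (sq_nonneg ω)]

/-- Ky Fan-type bound for the conjugate of `R_K + ‖·‖²`: testing a matrix of rank at most `p + k`
against a rescaling of `A`, whose singular values are at least `ω` at the first `p` positions and
at most `ω` elsewhere, gains no more than if `ω` were attained at the next `k` positions. -/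
theorem two_mul_frobInner_rescale_sub_le {m n p k : ℕ} (hpk : p + k ≤ n)
    (A X : Matrix (Fin m) (Fin n) ℂ) (hX : X.rank ≤ p + k) {d : Fin n → ℝ} {ω : ℝ}
    (hlow : ∀ j : Fin n, (j : ℕ) < p → ω ^ 2 ≤ (d j * (toEuclideanLin A).singularValues j) ^ 2)
    (hupp : ∀ j : Fin n, p ≤ (j : ℕ) → (d j * (toEuclideanLin A).singularValues j) ^ 2 ≤ ω ^ 2) :
    2 * frobInner X (rescale A d) - ‖X‖ ^ 2 ≤
      (∑ j : Fin n, if (j : ℕ) < p then (d j * (toEuclideanLin A).singularValues j) ^ 2 else 0) +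
        k * ω ^ 2 := by
  set T := Finset.univ.filter fun i : Fin n => (i : ℕ) < p + k with hT
  have hTcard : T.card = p + k := by
    rw [hT, Fin.card_filter_val_lt, min_eq_right hpk]
  have hzero : ∀ i : Fin n, i ∉ T → toEuclideanLin X (rightBasis X i) = 0 := by
    intro i hi
    have h := norm_sq_apply_rightBasis X i
    rw [LinearMap.singularValues_eq_zero_iff_le_finrank_range _ |>.2] at h
    · simpa using h
    · rw [finrank_range_toEuclideanLin]
      simp only [hT, Finset.mem_filter, Finset.mem_univ, true_and, not_lt] at hi
      omega
  -- In the right singular basis of `X` only the first `p + k` vectors contribute, and there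
  -- `2 Re⟨C v, X v⟩ - ‖X v‖² ≤ ‖C v‖²`.
  have h1 : 2 * frobInner X (rescale A d) - ‖X‖ ^ 2 ≤
      ∑ i ∈ T, ‖toEuclideanLin (rescale A d) (rightBasis X i)‖ ^ 2 := by
    rw [norm_sq_eq_frobInner, frobInner_eq_sum (rightBasis X), frobInner_eq_sum (rightBasis X),
      Finset.mul_sum, ← Finset.sum_sub_distrib, ← Finset.sum_subset (Finset.subset_univ T)]
    · refine Finset.sum_le_sum fun i _ => ?_
      have h := norm_sub_sq (𝕜 := ℂ) (toEuclideanLin (rescale A d) (rightBasis X i))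
        (toEuclideanLin X (rightBasis X i))
      rw [← inner_self_eq_norm_sq (𝕜 := ℂ) (toEuclideanLin X (rightBasis X i))] at h
      simp only [RCLike.re_to_complex] at h
      nlinarith [sq_nonneg ‖toEuclideanLin (rescale A d) (rightBasis X i) -
        toEuclideanLin X (rightBasis X i)‖]
    · intro i _ hi
      simp [hzero i hi]
  refine h1.trans ?_
  simp only [norm_rescale_apply_sq]
  rw [Finset.sum_comm]
  simp only [← Finset.mul_sum]
  refine sum_sq_mul_le (by omega) hlow hupp (fun j => by positivity) (fun j => ?_) ?_
  · calc ∑ i ∈ T, ‖⟪rightBasis A j, rightBasis X i⟫_ℂ‖ ^ 2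
        ≤ ∑ i, ‖⟪rightBasis A j, rightBasis X i⟫_ℂ‖ ^ 2 :=
          Finset.sum_le_sum_of_subset_of_nonneg (Finset.subset_univ _) fun _ _ _ => by positivity
      _ = 1 := by
          rw [(rightBasis X).sum_sq_norm_inner_left, (rightBasis A).norm_eq_one, one_pow]
  · rw [Finset.sum_comm]
    simp only [(rightBasis A).sum_sq_norm_inner_right, (rightBasis X).norm_eq_one]
    simp [hTcard]

end weights

/-! ### The flattened singular values and the two bounds -/

section flatten
variable {m n : ℕ}

/-- The factors that turn the singular values `s₁, s₂, …` of `A` into `s₁, …, s_p, ω, ω, …`.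
Where `s_j = 0` and `j > p`, the division by zero gives the factor `0` and the value stays `0`: this
does not change the pairing with `A`, and the upper bound `ω` is all that is needed there. -/
noncomputable def flattenFactor (A : Matrix (Fin m) (Fin n) ℂ) (p : ℕ) (ω : ℝ) (j : Fin n) : ℝ :=
  if (j : ℕ) < p then 1 else ω / (toEuclideanLin A).singularValues j

/-- The sum of the squares of the first `p` singular values, plus `k ω²`. Under `IsFlattening` and
with `p + k = K ≤ n`, it is the value at `A` of the convex envelope of `R_K + ‖·‖²`. -/
noncomputable def flattenedSq (A : Matrix (Fin m) (Fin n) ℂ) (p k : ℕ) (ω : ℝ) : ℝ :=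
  (∑ j : Fin n, if (j : ℕ) < p then (toEuclideanLin A).singularValues j ^ 2 else 0) + k * ω ^ 2

/-- `A`, `p`, `k`, `ω` satisfy the optimality conditions: the first `p` singular values are at
least `ω`, the others are at most `ω`, and the others sum to `k ω`. -/
structure IsFlattening (A : Matrix (Fin m) (Fin n) ℂ) (p k : ℕ) (ω : ℝ) : Prop where
  nonneg : 0 ≤ ω
  le_of_lt : ∀ j, j < p → ω ≤ (toEuclideanLin A).singularValues j
  le_of_ge : ∀ j, p ≤ j → (toEuclideanLin A).singularValues j ≤ ω
  sum_eq : (∑ j : Fin n, if p ≤ (j : ℕ) then (toEuclideanLin A).singularValues j else 0) = k * ω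

theorem flattenFactor_mul_of_lt (A : Matrix (Fin m) (Fin n) ℂ) {p : ℕ} (ω : ℝ) {j : Fin n}
    (hj : (j : ℕ) < p) : flattenFactor A p ω j * (toEuclideanLin A).singularValues j =
      (toEuclideanLin A).singularValues j := by
  rw [flattenFactor, if_pos hj, one_mul]

theorem flattenFactor_mul_sq_le (A : Matrix (Fin m) (Fin n) ℂ) {p : ℕ} (ω : ℝ) {j : Fin n}
    (hj : p ≤ (j : ℕ)) :
    (flattenFactor A p ω j * (toEuclideanLin A).singularValues j) ^ 2 ≤ ω ^ 2 := by
  rw [flattenFactor, if_neg (not_lt.2 hj)]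
  by_cases hs : (toEuclideanLin A).singularValues j = 0
  · simp [hs, sq_nonneg]
  · rw [div_mul_cancel₀ _ hs]

theorem sum_flattenFactor_eq (A : Matrix (Fin m) (Fin n) ℂ) (p : ℕ) (ω : ℝ) :
    (∑ j : Fin n, if (j : ℕ) < p then
      (flattenFactor A p ω j * (toEuclideanLin A).singularValues j) ^ 2 else 0) =
    ∑ j : Fin n, if (j : ℕ) < p then (toEuclideanLin A).singularValues j ^ 2 else 0 := by
  refine Finset.sum_congr rfl fun j _ => ?_
  split_ifs with hj
  · rw [flattenFactor_mul_of_lt A ω hj]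
  · rfl

variable {A : Matrix (Fin m) (Fin n) ℂ} {p k : ℕ} {ω : ℝ}

theorem IsFlattening.sq_le_flattenFactor_mul_sq (h : IsFlattening A p k ω) {j : Fin n}
    (hj : (j : ℕ) < p) :
    ω ^ 2 ≤ (flattenFactor A p ω j * (toEuclideanLin A).singularValues j) ^ 2 := by
  rw [flattenFactor_mul_of_lt A ω hj]
  exact pow_le_pow_left₀ h.nonneg (h.le_of_lt j hj) 2

theorem IsFlattening.frobInner_rescale (h : IsFlattening A p k ω) :
    frobInner (rescale A (flattenFactor A p ω)) A = flattenedSq A p k ω := by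
  have hterm : ∀ j : Fin n, flattenFactor A p ω j * (toEuclideanLin A).singularValues j ^ 2 =
      (if (j : ℕ) < p then (toEuclideanLin A).singularValues j ^ 2 else 0) +
        ω * if p ≤ (j : ℕ) then (toEuclideanLin A).singularValues j else 0 := by
    intro j
    unfold flattenFactor
    by_cases hj : (j : ℕ) < p
    · simp [hj, not_le.2 hj]
    · simp only [hj, not_lt.1 hj, if_true, if_false, zero_add]
      by_cases hs : (toEuclideanLin A).singularValues j = 0
      · simp [hs]
      · field_simp
  rw [frobInner_rescale_self, Finset.sum_congr rfl fun j _ => hterm j, Finset.sum_add_distrib,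
    ← Finset.mul_sum, h.sum_eq, flattenedSq]
  ring

/-- The dual certificate `2 C - 2 F`, where `C` is `A` with its small nonzero singular values
raised to `ω`, bounds the biconjugate from below. -/
theorem IsFlattening.le_fenchelConj_fenchelConj (h : IsFlattening A p k ω) (hpk : p + k ≤ n)
    (F : Matrix (Fin m) (Fin n) ℂ) :
    ((flattenedSq A p k ω - ‖A‖ ^ 2 + ‖A - F‖ ^ 2 : ℝ) : EReal) ≤
      fenchelConj (fenchelConj (fixedRankFunctional (p + k) F)) A := by
  set C := rescale A (flattenFactor A p ω) with hC
  set B := (2 : ℝ) • C - (2 : ℝ) • F with hB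
  have hconj : fenchelConj (fixedRankFunctional (p + k) F) B ≤
      ((flattenedSq A p k ω - ‖F‖ ^ 2 : ℝ) : EReal) := by
    refine iSup_le fun X => ?_
    unfold fixedRankFunctional rankIndicator
    split_ifs with hX
    · have hkf := two_mul_frobInner_rescale_sub_le hpk A X hX
        (fun j hj => h.sq_le_flattenFactor_mul_sq hj)
        (fun j hj => flattenFactor_mul_sq_le A ω hj)
      rw [sum_flattenFactor_eq, ← hC] at hkf
      rw [zero_add]
      norm_cast
      rw [norm_sub_sq_eq, frobInner_comm X B, hB, frobInner_sub_left, frobInner_smul_left,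
        frobInner_smul_left, frobInner_comm C, frobInner_comm F, flattenedSq]
      linarith
    · rw [EReal.top_add_coe, EReal.sub_top]
      exact bot_le
  refine le_trans ?_ (le_iSup (fun B => ((frobInner B A : ℝ) : EReal) -
    fenchelConj (fixedRankFunctional (p + k) F) B) B)
  refine le_trans (le_of_eq ?_) (EReal.sub_le_sub le_rfl hconj)
  norm_cast
  rw [norm_sub_sq_eq, hB, frobInner_sub_left, frobInner_smul_left, frobInner_smul_left,
    h.frobInner_rescale, frobInner_comm F]
  ring

/-- `A` is recovered from its flattening by weights in the hypersimplex. -/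
theorem IsFlattening.exists_weights (h : IsFlattening A p k ω) (hpk : p + k ≤ n) :
    ∃ x : Fin n → ℝ, (∀ j, 0 ≤ x j) ∧ (∀ j, x j ≤ 1) ∧ ∑ j, x j = (p + k : ℕ) ∧
      rescale A (flattenFactor A p ω * x) = A := by
  have hcard : ∀ r : ℕ, r ≤ n → (∑ j : Fin n, if (j : ℕ) < r then (1 : ℝ) else 0) = r := by
    intro r hr
    rw [← Finset.sum_filter, Finset.sum_const, Fin.card_filter_val_lt, min_eq_right hr]
    simp
  rcases h.nonneg.eq_or_lt with hω | hω
  · -- Here `A` has rank at most `p`, and the weights beyond position `p` do not matter.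
    refine ⟨fun j => if (j : ℕ) < p + k then 1 else 0, fun j => by
      dsimp only; split_ifs <;> norm_num, fun j => by dsimp only; split_ifs <;> norm_num,
      hcard _ hpk, rescale_eq_self fun j => ?_⟩
    by_cases hj : (j : ℕ) < p
    · simp [flattenFactor, hj, show (j : ℕ) < p + k by omega]
    · have hs : (toEuclideanLin A).singularValues j = 0 :=
        le_antisymm (hω ▸ h.le_of_ge j (not_lt.1 hj)) ((toEuclideanLin A).singularValues_nonneg j)
      simp [hs]
  · refine ⟨fun j => if (j : ℕ) < p then 1 else (toEuclideanLin A).singularValues j / ω,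
      fun j => ?_, fun j => ?_, ?_, rescale_eq_self fun j => ?_⟩
    · dsimp only
      split_ifs
      · norm_num
      · exact div_nonneg ((toEuclideanLin A).singularValues_nonneg j) hω.le
    · dsimp only
      split_ifs with hj
      · exact le_rfl
      · exact (div_le_one hω).2 (h.le_of_ge j (not_lt.1 hj))
    · have hterm : ∀ j : Fin n,
          (if (j : ℕ) < p then 1 else (toEuclideanLin A).singularValues j / ω) =
          (if (j : ℕ) < p then 1 else 0) +
            (if p ≤ (j : ℕ) then (toEuclideanLin A).singularValues j else 0) / ω := by
        intro j
        by_cases hj : (j : ℕ) < p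
        · simp [hj, not_le.2 hj]
        · simp [hj, not_lt.1 hj]
      rw [Finset.sum_congr rfl fun j _ => hterm j, Finset.sum_add_distrib, ← Finset.sum_div,
        h.sum_eq, hcard p (by omega), mul_div_cancel_right₀ _ hω.ne']
      push_cast
      rfl
    · simp only [Pi.mul_apply, flattenFactor]
      split_ifs with hj
      · ring
      · by_cases hs : (toEuclideanLin A).singularValues j = 0
        · simp [hs]
        · field_simp

theorem IsFlattening.norm_rescale_indicator_sq_le (h : IsFlattening A p k ω) (hp : p ≤ n)
    {S : Finset (Fin n)} (hS : S.card = p + k) :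
    ‖rescale A (flattenFactor A p ω * (S : Set (Fin n)).indicator fun _ => (1 : ℝ))‖ ^ 2 ≤
      flattenedSq A p k ω := by
  classical
  rw [norm_rescale_sq]
  have hw := sum_sq_mul_le (k := k) hp (w := (S : Set (Fin n)).indicator fun _ => (1 : ℝ))
    (fun j hj => h.sq_le_flattenFactor_mul_sq hj) (fun j hj => flattenFactor_mul_sq_le A ω hj)
    (fun j => Set.indicator_nonneg (fun _ _ => zero_le_one) j)
    (fun j => by by_cases hj : j ∈ S <;> simp [hj])
    (by simp [Set.indicator_apply, hS])
  rw [sum_flattenFactor_eq] at hw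
  refine le_trans (le_of_eq (Finset.sum_congr rfl fun j _ => ?_)) hw
  by_cases hj : j ∈ S <;> simp [hj]

/-- Every convex minorant is bounded above by the claimed value, because `A` is a convex
combination of matrices of rank at most `p + k` whose squared norms are at most
`flattenedSq A p k ω`. -/
theorem IsFlattening.le_of_isConvex (h : IsFlattening A p k ω) (hpk : p + k ≤ n)
    (F : Matrix (Fin m) (Fin n) ℂ) {g : Matrix (Fin m) (Fin n) ℂ → EReal} (hg : IsConvex g)
    (hle : g ≤ fixedRankFunctional (p + k) F) :
    g A ≤ ((flattenedSq A p k ω - ‖A‖ ^ 2 + ‖A - F‖ ^ 2 : ℝ) : EReal) := by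
  obtain ⟨x, hx0, hx1, hxsum, hxA⟩ := h.exists_weights hpk
  let M : (Fin n → ℝ) → Matrix (Fin m) (Fin n) ℂ := fun y => rescale A (flattenFactor A p ω * y)
  let r : (Fin n → ℝ) → ℝ := fun y => flattenedSq A p k ω - 2 * frobInner (M y) F + ‖F‖ ^ 2
  have hM : ∀ (s t : ℝ) (y z : Fin n → ℝ), M (s • y + t • z) = s • M y + t • M z := by
    intro s t y z
    simp only [M]
    rw [← rescale_linear, mul_add, mul_smul_comm, mul_smul_comm]
  have hconv : Convex ℝ {y | g (M y) ≤ (r y : EReal)} := by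
    intro y hy z hz s t hs ht hst
    have hmem := hg (x := (M y, r y)) hy (y := (M z, r z)) hz hs ht hst
    have hr : r (s • y + t • z) = s * r y + t * r z := by
      simp only [r, hM, frobInner_add_left, frobInner_smul_left]
      linear_combination (-(flattenedSq A p k ω) - ‖F‖ ^ 2) * hst
    simp only [Set.mem_ofPred_eq, Prod.fst_add, Prod.smul_fst, Prod.snd_add, Prod.smul_snd,
      smul_eq_mul] at hmem ⊢
    rw [hM, hr]
    exact hmem
  have hmem := mem_of_mem_hypersimplex hconv (fun S hS => ?_) x hx0 hx1 hxsum
  · simp only [Set.mem_ofPred_eq, M, r, hxA] at hmem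
    rw [norm_sub_sq_eq]
    convert hmem using 2
    ring
  · have hrank : (M ((S : Set (Fin n)).indicator fun _ => (1 : ℝ))).rank ≤ p + k := by
      rw [← hS]
      exact rank_rescale_le A _ S fun j hj => by simp [hj]
    refine (hle _).trans ?_
    rw [fixedRankFunctional, rankIndicator, if_pos hrank, zero_add, norm_sub_sq_eq]
    have := h.norm_rescale_indicator_sq_le (by omega) hS
    simp only [r]
    exact_mod_cast by linarith

end flatten

/-! ### The formula in terms of `k_*` -/

/-- Passing from the one-based indices up to `min m n` to the zero-based indices below `n`. -/
theorem sum_Icc_pred_eq {m n : ℕ} (p : ℕ) {f : ℕ → ℝ} (hf : ∀ i, m ≤ i → f i = 0) :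
    ∑ j ∈ Finset.Icc (p + 1) (min m n), f (j - 1) =
      ∑ j : Fin n, if p ≤ (j : ℕ) then f j else 0 := by
  rw [Fin.sum_univ_eq_sum_range (fun i => if p ≤ i then f i else 0), ← Finset.sum_filter]
  refine Finset.sum_bij_ne_zero (fun j _ _ => j - 1) ?_ ?_ ?_ (fun _ _ _ => rfl)
  · intro j hj _
    simp only [Finset.mem_Icc, Finset.mem_filter, Finset.mem_range] at hj ⊢
    omega
  · intro i hi _ j hj _ hij
    simp only [Finset.mem_Icc] at hi hj
    omega
  · intro i hi hne
    have : i < m := not_le.1 fun hmi => hne (hf i hmi)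
    simp only [Finset.mem_filter, Finset.mem_range] at hi
    refine ⟨i + 1, ?_, by simpa using hne, by simp⟩
    simp only [Finset.mem_Icc]
    omega

theorem singularValues_eq_zero_of_le {m n : ℕ} (A : Matrix (Fin m) (Fin n) ℂ) {i : ℕ}
    (hi : m ≤ i) : (toEuclideanLin A).singularValues i = 0 := by
  rw [LinearMap.singularValues_eq_zero_iff_le_finrank_range, finrank_range_toEuclideanLin]
  exact (rank_le_height A).trans hi

theorem IsKStar.mul_omega_eq {N K k : ℕ} {β : ℕ → ℝ} (h : IsKStar N K β k) :
    k * omega N K β k = ∑ j ∈ Finset.Icc (K - k + 1) N, β j := by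
  have : (k : ℝ) ≠ 0 := by have := h.1; positivity
  rw [omega, mul_div_cancel₀ _ this]

theorem IsKStar.isFlattening {m n K k : ℕ} {A : Matrix (Fin m) (Fin n) ℂ}
    (h : IsKStar (min m n) K (sv A) k) :
    IsFlattening A (K - k) k (omega (min m n) K (sv A) k) where
  nonneg := div_nonneg (Finset.sum_nonneg fun j _ => LinearMap.singularValues_nonneg _ _)
    (Nat.cast_nonneg k)
  le_of_lt j hj :=
    (h.2.2.2 (by omega)).le.trans (LinearMap.singularValues_antitone _ (by omega))
  le_of_ge j hj := (LinearMap.singularValues_antitone _ (by omega)).trans h.2.2.1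
  sum_eq := by
    rw [h.mul_omega_eq, ← sum_Icc_pred_eq (m := m) _ fun i hi => singularValues_eq_zero_of_le A hi]
    rfl

theorem IsKStar.flattenedSq_sub_norm_sq {m n K k : ℕ} {A : Matrix (Fin m) (Fin n) ℂ}
    (h : IsKStar (min m n) K (sv A) k) :
    flattenedSq A (K - k) k (omega (min m n) K (sv A) k) - ‖A‖ ^ 2 =
      1 / (k : ℝ) * (∑ j ∈ Finset.Icc (K - k + 1) (min m n), sv A j) ^ 2 -
        ∑ j ∈ Finset.Icc (K - k + 1) (min m n), sv A j ^ 2 := by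
  have hk : (k : ℝ) ≠ 0 := by have := h.1; positivity
  have hsq : ∑ j ∈ Finset.Icc (K - k + 1) (min m n), sv A j ^ 2 =
      ∑ j : Fin n, if K - k ≤ (j : ℕ) then (toEuclideanLin A).singularValues j ^ 2 else 0 :=
    sum_Icc_pred_eq (m := m) (f := fun i => (toEuclideanLin A).singularValues i ^ 2) _
      fun i hi => by simp [singularValues_eq_zero_of_le A hi]
  have hsplit : ‖A‖ ^ 2 =
      (∑ j : Fin n, if (j : ℕ) < K - k then (toEuclideanLin A).singularValues j ^ 2 else 0) +
      ∑ j : Fin n, if K - k ≤ (j : ℕ) then (toEuclideanLin A).singularValues j ^ 2 else 0 := by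
    rw [norm_sq_eq_sum_singularValues, ← Finset.sum_add_distrib]
    refine Finset.sum_congr rfl fun j _ => ?_
    by_cases hj : (j : ℕ) < K - k
    · simp [hj, not_le.2 hj]
    · simp [hj, not_lt.1 hj]
  rw [← h.mul_omega_eq, hsq, hsplit, flattenedSq]
  field_simp
  ring

end FixedRank

theorem theorem1 (m n K : ℕ) (hK : 1 ≤ K) (hKN : K < min m n) (F : Matrix (Fin m) (Fin n) ℂ) :
    FixedRank.IsConvexEnvelope (FixedRank.fixedRankFunctional K F)
      (FixedRank.fenchelConj (FixedRank.fenchelConj (FixedRank.fixedRankFunctional K F))) ∧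
    ∀ A : Matrix (Fin m) (Fin n) ℂ,
      (∃! k : ℕ, FixedRank.IsKStar (min m n) K (FixedRank.sv A) k) ∧
      ∀ k : ℕ, FixedRank.IsKStar (min m n) K (FixedRank.sv A) k →
        FixedRank.fenchelConj (FixedRank.fenchelConj (FixedRank.fixedRankFunctional K F)) A =
          (((1 / (k : ℝ)) * (∑ j ∈ Finset.Icc (K - k + 1) (min m n), FixedRank.sv A j) ^ 2
            - ∑ j ∈ Finset.Icc (K - k + 1) (min m n), FixedRank.sv A j ^ 2
            + ‖A - F‖ ^ 2 : ℝ) : EReal) := by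
  have hstar : ∀ A : Matrix (Fin m) (Fin n) ℂ,
      ∃! k : ℕ, FixedRank.IsKStar (min m n) K (FixedRank.sv A) k := fun A =>
    FixedRank.existsUnique_isKStar hK hKN
      (fun i j hij => LinearMap.singularValues_antitone _ (by omega))
      (fun j => LinearMap.singularValues_nonneg _ _)
  have hlower : ∀ (A : Matrix (Fin m) (Fin n) ℂ) (k : ℕ),
      FixedRank.IsKStar (min m n) K (FixedRank.sv A) k →
      ((FixedRank.flattenedSq A (K - k) k (FixedRank.omega (min m n) K (FixedRank.sv A) k) -
        ‖A‖ ^ 2 + ‖A - F‖ ^ 2 : ℝ) : EReal) ≤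
      FixedRank.fenchelConj (FixedRank.fenchelConj (FixedRank.fixedRankFunctional K F)) A := by
    intro A k h
    have hKk : K - k + k = K := Nat.sub_add_cancel h.2.1
    simpa only [hKk] using h.isFlattening.le_fenchelConj_fenchelConj (by omega) F
  have hupper : ∀ (A : Matrix (Fin m) (Fin n) ℂ) (k : ℕ),
      FixedRank.IsKStar (min m n) K (FixedRank.sv A) k →
      ∀ g, FixedRank.IsConvex g → g ≤ FixedRank.fixedRankFunctional K F → g A ≤
      ((FixedRank.flattenedSq A (K - k) k (FixedRank.omega (min m n) K (FixedRank.sv A) k) -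
        ‖A‖ ^ 2 + ‖A - F‖ ^ 2 : ℝ) : EReal) := by
    intro A k h g hg hle
    have hKk : K - k + k = K := Nat.sub_add_cancel h.2.1
    exact h.isFlattening.le_of_isConvex (by omega) F hg (hKk.symm ▸ hle)
  have hconv := FixedRank.isConvex_fenchelConj
    (FixedRank.fenchelConj (FixedRank.fixedRankFunctional K F))
  have hmin := FixedRank.fenchelConj_fenchelConj_le (FixedRank.fixedRankFunctional K F)
  refine ⟨⟨⟨hconv, hmin⟩, fun g hg A => ?_⟩, fun A => ⟨hstar A, fun k h => ?_⟩⟩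
  · obtain ⟨k, h, -⟩ := hstar A
    exact (hupper A k h g hg.1 hg.2).trans (hlower A k h)
  · rw [← h.flattenedSq_sub_norm_sq]
    exact le_antisymm (hupper A k h _ hconv hmin) (hlower A k h)
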